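/- Let $d\ge 1$, $\lambda>0$, $R\ge 0$, and let $z_i=(a_i,b_i)\in\mathbb{R}^d\times\mathbb{R}$, $i=1,\dots,N$, be a data set with $\|a_i\|\le R$ for all $i$. Consider the quadratic losses $\ell(x,z_i)=\frac12(a_i^\top x-b_i)^2+\frac{\lambda}{2}\|x\|^2$ and the overall empirical risk $F(x)=\frac1N\sum_{i=1}^N\ell(x,z_i)$. Draw indices $I_1,\dots,I_n$ independently and uniformly from $\{1,\dots,N\}$ (sampling with replacement) and let $f(x)=\frac1n\sum_{i=1}^n\ell(x,z_{I_i})$. Write $H_F=\nabla^2F(x)$ and $H_f=\nabla^2 f(x)$ (they do not depend on $x$), and $\kappa_\ell=R^2/\lambda$. Let $\preceq$ be the Loewner order. For a convex twice differentiable $\phi$, a twice differentiable $F$ is called $L$-smooth and $\sigma$-strongly convex relative to $\phi$ if $\sigma\nabla^2\phi(x)\preceq\nabla^2F(x)\preceq L\nabla^2\phi(x)$ for all $x$; the corresponding relative condition number is $\kappa_{F/\phi}=L/\sigma$. Let $\delta>0$ and suppose $n>\frac{28}{3}\log\left(\frac{2d}{\delta}\right)$. Put $$\mu=\frac12\left(\frac{28R^2}{3n}\log\left(\frac{2d}{\delta}\right)-\lambda\right)^+,\qquad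 \phi(x)=f(x)+\frac{\mu}{2}\|x\|^2 .$$ Then, with probability at least $1-\delta$, the following hold simultaneously: 1. $\left(\frac32+\frac{2\mu}{\lambda}\right)^{-1}(H_f+\mu I_d)\preceq H_F\preceq 2\,(H_f+\mu I_d)$; 2. $F$ is $L_{F/\phi}$-smooth and $\sigma_{F/\phi}$-strongly convex relative to $\phi$ with $L_{F/\phi}=2$ and $\sigma_{F/\phi}=\left(\frac32+\frac{2\mu}{\lambda}\right)^{-1}$; 3. the corresponding relative condition number $\kappa_{F/\phi}=L_{F/\phi}/\sigma_{F/\phi}$ satisfies $$\kappa_{F/\phi}\le C\left(1+\frac{\kappa_\ell}{n}\log\left(\frac{2d}{\delta}\right)\right),\qquad\text{and}\qquad \kappa_{F/\phi}\le C\left(1+\frac{\kappa_\ell}{n}\log\left(\frac{d}{\delta}\right)\right)\ \text{ if } d/\delta\ge 2,$$ where $C>0$ is an absolute constant (independent of $d,n,N,R,\lambda,\delta$ and the data). -/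

import Mathlib

open MeasureTheory ProbabilityTheory
open scoped ENNReal MatrixOrder

/-- The Hessian matrix `∇²g(x)` of a function `g : ℝᵈ → ℝ`, with entries `∂ᵢ∂ⱼ g (x)`. -/
noncomputable def hessian {d : ℕ} (g : EuclideanSpace ℝ (Fin d) → ℝ)
    (x : EuclideanSpace ℝ (Fin d)) : Matrix (Fin d) (Fin d) ℝ :=
  Matrix.of fun i j =>
    fderiv ℝ (fderiv ℝ g) x (EuclideanSpace.single i 1) (EuclideanSpace.single j 1)

/-- The function `g` is twice differentiable on `ℝᵈ`. -/
def TwiceDifferentiable {d : ℕ} (g : EuclideanSpace ℝ (Fin d) → ℝ) : Prop :=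
  Differentiable ℝ g ∧ Differentiable ℝ (fderiv ℝ g)

/-- `F` is `L`-smooth and `σ`-strongly convex relative to the convex twice differentiable
reference function `φ`: `σ ∇²φ(x) ⪯ ∇²F(x) ⪯ L ∇²φ(x)` for all `x`.
The order on matrices is the Loewner order: `A ≤ B` iff `B - A` is positive semidefinite. -/
structure RelSmoothStronglyConvex {d : ℕ} (F φ : EuclideanSpace ℝ (Fin d) → ℝ)
    (L σ : ℝ) : Prop where
  convex_ref : ConvexOn ℝ Set.univ φ
  twiceDifferentiable_ref : TwiceDifferentiable φ
  twiceDifferentiable : TwiceDifferentiable F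
  strong : ∀ x, σ • hessian φ x ≤ hessian F x
  smooth : ∀ x, hessian F x ≤ L • hessian φ x

/-- The regularized quadratic loss `ℓ(x, (a, b)) = (aᵀx - b)² / 2 + (lam / 2) ‖x‖²`
of a linear model. -/
noncomputable def quadLoss {d : ℕ} (lam : ℝ) (x : EuclideanSpace ℝ (Fin d))
    (z : EuclideanSpace ℝ (Fin d) × ℝ) : ℝ :=
  (inner ℝ z.1 x - z.2) ^ 2 / 2 + lam / 2 * ‖x‖ ^ 2

/-- The empirical risk `x ↦ (1 / k) ∑ᵢ ℓ(x, zᵢ)` of a data set `z₁, …, z_k`. -/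
noncomputable def empiricalRisk {d k : ℕ} (lam : ℝ)
    (z : Fin k → EuclideanSpace ℝ (Fin d) × ℝ) (x : EuclideanSpace ℝ (Fin d)) : ℝ :=
  (1 / (k : ℝ)) * ∑ i, quadLoss lam x (z i)

/-- `idx₁, …, idx_n` is a uniform sample with replacement from `{1, …, N}`: the indices are
independent and each of them is uniformly distributed. -/
structure IsUniformSample {Ω : Type*} [MeasurableSpace Ω] (P : Measure Ω) {n N : ℕ}
    (idx : Fin n → Ω → Fin N) : Prop where
  measurable : ∀ i, Measurable (idx i)
  indep : iIndepFun idx P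
  uniform : ∀ i k, P {ω | idx i ω = k} = (N : ℝ≥0∞)⁻¹

/-- The regularization level `μ = ½ ((28 R² / (3 n)) log (2 d / δ) - lam)⁺`. -/
noncomputable def precondMu (d n : ℕ) (R lam δ : ℝ) : ℝ :=
  1 / 2 * max (28 * R ^ 2 / (3 * n) * Real.log (2 * d / δ) - lam) 0

/-- The reference function `φ(x) = f(x) + (μ / 2) ‖x‖²`. -/
noncomputable def referenceFun {d : ℕ} (f : EuclideanSpace ℝ (Fin d) → ℝ) (μ : ℝ)
    (x : EuclideanSpace ℝ (Fin d)) : ℝ :=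
  f x + μ / 2 * ‖x‖ ^ 2

/-! Both Hessians are explicit: `H_F = S + λI` and `H_f = T + λI`, where `S` is the mean of the
matrices `a aᵀ` over the data and `T` their mean over the sample. With `β = λ + 2μ`, everything
follows from the two-sided relative bound `±(T - S) ≤ ½(S + βI)`: one sign gives the factor `2`, the
other the factor `3/2 + 2μ/λ`.

To prove that bound, conjugate by `(S + βI)^(-1/2)`. The summands become positive semidefinite
matrices bounded by `r` as soon as `R² ≤ βr`, their mean is at most `I`, and so their variance is at
most `r`. Matrix Bernstein at deviation `1/2` bounds each tail by `d exp(-3n/(28r))`. The definition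
of `μ` gives `β = max(28R²L/(3n), λ)` with `L = log(2d/δ)`, so `r = 3n/(28L)` is admissible and each
tail is at most `δ/2`.

Bernstein is proved by the Laplace transform. The Golden–Thompson inequality (`trace_exp_add_le`)
peels off one sample at a time (`sum_trace_exp_sum_le`); it rests on the Lie–Trotter formula and on
trace inequalities for powers of two. Since the sampling is uniform on a finite set, expectations
are sums over all index tuples and tails are cardinalities; `IsUniformSample.measure_mem_le_ofReal`
turns them into probabilities. -/

/-! ### The Lie–Trotter product formula -/

section LieTrotter

open NormedSpace Filter Topology

variable {𝔸 : Type*} [NormedRing 𝔸]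

theorem norm_pow_sub_pow_le_of_norm_le [NormOneClass 𝔸] {X Y : 𝔸} {M : ℝ}
    (hX : ‖X‖ ≤ M) (hY : ‖Y‖ ≤ M) (n : ℕ) :
    ‖X ^ (n + 1) - Y ^ (n + 1)‖ ≤ (n + 1) * ‖X - Y‖ * M ^ n := by
  have hM : 0 ≤ M := (norm_nonneg X).trans hX
  induction n with
  | zero => simp
  | succ n ih =>
    have hsplit : X ^ (n + 1 + 1) - Y ^ (n + 1 + 1)
        = X ^ (n + 1) * (X - Y) + (X ^ (n + 1) - Y ^ (n + 1)) * Y := by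
      rw [pow_succ X (n + 1), pow_succ Y (n + 1)]; noncomm_ring
    have hXn : ‖X ^ (n + 1)‖ ≤ M ^ (n + 1) :=
      (norm_pow_le X _).trans (pow_le_pow_left₀ (norm_nonneg _) hX _)
    calc ‖X ^ (n + 1 + 1) - Y ^ (n + 1 + 1)‖
        ≤ ‖X ^ (n + 1)‖ * ‖X - Y‖ + ‖X ^ (n + 1) - Y ^ (n + 1)‖ * ‖Y‖ := by
          rw [hsplit]
          exact (norm_add_le _ _).trans (add_le_add (norm_mul_le _ _) (norm_mul_le _ _))
      _ ≤ M ^ (n + 1) * ‖X - Y‖ + ((n + 1) * ‖X - Y‖ * M ^ n) * M := by gcongr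
      _ = ((n + 1 : ℕ) + 1) * ‖X - Y‖ * M ^ (n + 1) := by push_cast; ring

variable [NormedAlgebra ℝ 𝔸]

theorem norm_exp_le_exp_norm_of_normOneClass [NormOneClass 𝔸] (x : 𝔸) :
    ‖exp x‖ ≤ Real.exp ‖x‖ := by
  have h : HasSum (fun k : ℕ => ‖x‖ ^ k / (k.factorial : ℝ)) (Real.exp ‖x‖) := by
    rw [Real.exp_eq_exp_ℝ]
    exact expSeries_div_hasSum_exp ‖x‖
  rw [congrFun (exp_eq_tsum (𝔸 := 𝔸) ℝ) x]
  refine tsum_of_norm_bounded h fun k => ?_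
  rw [norm_smul, norm_inv, Real.norm_natCast, div_eq_inv_mul]
  gcongr
  exact norm_pow_le x k

variable [CompleteSpace 𝔸]

theorem exp_inv_natCast_smul_pow {m : ℕ} (hm : m ≠ 0) (Z : 𝔸) :
    exp ((m : ℝ)⁻¹ • Z) ^ m = exp Z := by
  let _ : NormedAlgebra ℚ 𝔸 := NormedAlgebra.restrictScalars ℚ ℝ 𝔸
  rw [← exp_nsmul, ← Nat.cast_smul_eq_nsmul ℝ, smul_smul, mul_inv_cancel₀ (by exact_mod_cast hm),
    one_smul]

/-- The **Lie–Trotter product formula**. -/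
theorem tendsto_exp_mul_exp_pow [NormOneClass 𝔸] (A B : 𝔸) :
    Tendsto (fun n : ℕ => (exp ((n + 1 : ℝ)⁻¹ • A) * exp ((n + 1 : ℝ)⁻¹ • B)) ^ (n + 1))
      atTop (𝓝 (exp (A + B))) := by
  -- `D` vanishes to first order at `0`, so `(n + 1) D(1 / (n + 1))` tends to `0`; telescoping the
  -- powers costs only the factor `n + 1` and a bounded one.
  let D : ℝ → 𝔸 := fun t => exp (t • A) * exp (t • B) - exp (t • (A + B))
  have hD : HasDerivAt D 0 0 := by
    have h := ((hasDerivAt_exp_smul_const (𝕂 := ℝ) A 0).mul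
      (hasDerivAt_exp_smul_const (𝕂 := ℝ) B 0)).sub
      (hasDerivAt_exp_smul_const (𝕂 := ℝ) (A + B) 0)
    refine h.congr_deriv ?_
    simp
  have hD0 : D 0 = 0 := by simp [D, exp_zero]
  have ht : Tendsto (fun n : ℕ => (n + 1 : ℝ)⁻¹) atTop (𝓝[≠] 0) := by
    refine tendsto_nhdsWithin_iff.2 ⟨?_, Eventually.of_forall fun n => ?_⟩
    · simpa using tendsto_one_div_add_atTop_nhds_zero_nat (𝕜 := ℝ)
    · simp only [Set.mem_compl_iff, Set.mem_singleton_iff]; positivity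
  have hslope : Tendsto (fun n : ℕ => (n + 1 : ℝ) • D ((n + 1 : ℝ)⁻¹)) atTop (𝓝 0) := by
    have h := (hasDerivAt_iff_tendsto_slope.1 hD).comp ht
    refine h.congr fun n => ?_
    simp [slope, hD0]
  have hlim : Tendsto
      (fun n : ℕ => ‖(n + 1 : ℝ) • D ((n + 1 : ℝ)⁻¹)‖ * Real.exp (‖A‖ + ‖B‖)) atTop (𝓝 0) := by
    simpa using hslope.norm.mul_const (Real.exp (‖A‖ + ‖B‖))
  rw [tendsto_iff_norm_sub_tendsto_zero]
  refine squeeze_zero (fun _ => norm_nonneg _) (fun n => ?_) hlim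
  have hn : (0 : ℝ) < n + 1 := by positivity
  have hpow : exp (A + B) = exp ((n + 1 : ℝ)⁻¹ • (A + B)) ^ (n + 1) := by
    rw [← exp_inv_natCast_smul_pow n.succ_ne_zero (A + B)]
    push_cast
    rfl
  set M := Real.exp ((n + 1 : ℝ)⁻¹ * (‖A‖ + ‖B‖))
  have hsm (Z : 𝔸) : ‖exp ((n + 1 : ℝ)⁻¹ • Z)‖ ≤ Real.exp ((n + 1 : ℝ)⁻¹ * ‖Z‖) := by
    refine (norm_exp_le_exp_norm_of_normOneClass _).trans_eq ?_
    rw [norm_smul, Real.norm_of_nonneg (inv_pos.2 hn).le]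
  have hX : ‖exp ((n + 1 : ℝ)⁻¹ • A) * exp ((n + 1 : ℝ)⁻¹ • B)‖ ≤ M := by
    refine (norm_mul_le _ _).trans ?_
    calc _ ≤ Real.exp ((n + 1 : ℝ)⁻¹ * ‖A‖) * Real.exp ((n + 1 : ℝ)⁻¹ * ‖B‖) := by
          gcongr <;> exact hsm _
      _ = M := by rw [← Real.exp_add, ← mul_add]
  have hY : ‖exp ((n + 1 : ℝ)⁻¹ • (A + B))‖ ≤ M := by
    refine (hsm _).trans (Real.exp_le_exp.2 ?_)
    gcongr
    exact norm_add_le _ _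
  have hM : M ^ n ≤ Real.exp (‖A‖ + ‖B‖) := by
    rw [← Real.exp_nat_mul]
    refine Real.exp_le_exp.2 ?_
    rw [← mul_assoc]
    refine mul_le_of_le_one_left (by positivity) ?_
    rw [← div_eq_mul_inv, div_le_one hn]
    linarith
  rw [hpow]
  refine (norm_pow_sub_pow_le_of_norm_le hX hY n).trans ?_
  rw [norm_smul, Real.norm_of_nonneg hn.le]
  gcongr

end LieTrotter

/-! ### Trace inequalities and Golden–Thompson -/

namespace Matrix

section Trace

variable {ι : Type*} [Fintype ι] [DecidableEq ι]

theorem trace_mul_pow_comm (A B : Matrix ι ι ℝ) (m : ℕ) :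
    ((A * B) ^ m).trace = ((B * A) ^ m).trace := by
  cases m with
  | zero => simp
  | succ m =>
    rw [pow_succ, ← mul_assoc, mul_pow_mul, Matrix.mul_assoc, trace_mul_comm, Matrix.mul_assoc,
      ← pow_succ]

theorem trace_sq_le_trace_mul_transpose (M : Matrix ι ι ℝ) :
    (M ^ 2).trace ≤ (M * Mᵀ).trace := by
  have h : 0 ≤ ((M - Mᵀ) * (M - Mᵀ)ᵀ).trace := by
    simpa using (posSemidef_self_mul_conjTranspose (M - Mᵀ)).trace_nonneg
  have h1 : (Mᵀ * Mᵀ).trace = (M * M).trace := by rw [← transpose_mul, trace_transpose]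
  have h2 : (Mᵀ * M).trace = (M * Mᵀ).trace := trace_mul_comm _ _
  simp only [transpose_sub, transpose_transpose, Matrix.sub_mul, Matrix.mul_sub, trace_sub,
    h1, h2] at h
  rw [sq]
  linarith

/-- Expand the squared Frobenius norm of `P ^ m - Q ^ m`. The use is for `MᵀM` and `MMᵀ`, whose
powers have equal traces. -/
theorem trace_pow_mul_pow_le {P Q : Matrix ι ι ℝ} (hP : P.IsSymm) (hQ : Q.IsSymm) {m : ℕ}
    (h : (P ^ (2 * m)).trace = (Q ^ (2 * m)).trace) :
    (P ^ m * Q ^ m).trace ≤ (Q ^ (2 * m)).trace := by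
  have h0 : 0 ≤ ((P ^ m - Q ^ m) * (P ^ m - Q ^ m)ᵀ).trace := by
    simpa using (posSemidef_self_mul_conjTranspose (P ^ m - Q ^ m)).trace_nonneg
  have h2 : (Q ^ m * P ^ m).trace = (P ^ m * Q ^ m).trace := trace_mul_comm _ _
  simp only [transpose_sub, transpose_pow, hP.eq, hQ.eq, Matrix.sub_mul, Matrix.mul_sub, trace_sub,
    h2, ← pow_add, ← two_mul] at h0
  linarith

/-- With `M = PQ`, `H` passes from `PQ` to `PQQP`, which has the same power traces as `P²Q²`; this
halves the exponent. Keeping `H` as a hypothesis below `k` allows a joint induction with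
`trace_pow_two_pow_succ_le`. -/
theorem trace_mul_pow_two_pow_le_of_forall {k : ℕ}
    (H : ∀ j < k, ∀ M : Matrix ι ι ℝ, (M ^ 2 ^ (j + 1)).trace ≤ ((M * Mᵀ) ^ 2 ^ j).trace) :
    ∀ P Q : Matrix ι ι ℝ, P.IsSymm → Q.IsSymm →
      ((P * Q) ^ 2 ^ k).trace ≤ (P ^ 2 ^ k * Q ^ 2 ^ k).trace := by
  induction k with
  | zero => intro P Q _ _; simp
  | succ k ih =>
    intro P Q hP hQ
    have h1 := H k (Nat.lt_succ_self k) (P * Q)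
    have h2 : ((P * Q * (P * Q)ᵀ) ^ 2 ^ k).trace = ((P ^ 2 * Q ^ 2) ^ 2 ^ k).trace := by
      rw [transpose_mul, hP.eq, hQ.eq, Matrix.mul_assoc, trace_mul_pow_comm, sq, sq,
        ← Matrix.mul_assoc, ← Matrix.mul_assoc, Matrix.mul_assoc (Q * Q) P P, trace_mul_pow_comm,
        Matrix.mul_assoc (P * P)]
    have h3 := ih (fun j hj => H j (hj.trans (Nat.lt_succ_self k))) (P ^ 2) (Q ^ 2)
      (hP.pow 2) (hQ.pow 2)
    rw [← pow_mul, ← pow_mul, ← pow_succ'] at h3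
    exact (h1.trans_eq h2).trans h3

theorem trace_pow_two_pow_succ_le (k : ℕ) (M : Matrix ι ι ℝ) :
    (M ^ 2 ^ (k + 1)).trace ≤ ((M * Mᵀ) ^ 2 ^ k).trace := by
  induction k using Nat.strong_induction_on generalizing M with
  | _ k ih =>
    cases k with
    | zero => simpa using trace_sq_le_trace_mul_transpose M
    | succ k =>
      have hP : (Mᵀ * M).IsSymm := isSymm_transpose_mul_self M
      have hQ : (M * Mᵀ).IsSymm := isSymm_mul_transpose_self M
      -- Applied to `M²`, the induction hypothesis produces `M²(M²)ᵀ`, cyclically equivalent to the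
      -- product of the symmetric matrices `MᵀM` and `MMᵀ`.
      have h1 := ih k (Nat.lt_succ_self k) (M ^ 2)
      rw [← pow_mul, ← pow_succ'] at h1
      have h2 : ((M ^ 2 * (M ^ 2)ᵀ) ^ 2 ^ k).trace = ((Mᵀ * M * (M * Mᵀ)) ^ 2 ^ k).trace := by
        rw [sq, transpose_mul, Matrix.mul_assoc, trace_mul_pow_comm, trace_mul_pow_comm (Mᵀ * M),
          Matrix.mul_assoc, Matrix.mul_assoc, Matrix.mul_assoc]
      have h3 := trace_mul_pow_two_pow_le_of_forall
        (fun j hj => ih j (hj.trans (Nat.lt_succ_self k))) _ _ hP hQ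
      have h4 := trace_pow_mul_pow_le hP hQ (m := 2 ^ k) (trace_mul_pow_comm _ _ _)
      rw [← pow_succ'] at h4
      exact (h1.trans_eq h2).trans (h3.trans h4)

theorem trace_mul_pow_two_pow_le {P Q : Matrix ι ι ℝ} (hP : P.IsSymm) (hQ : Q.IsSymm) (k : ℕ) :
    ((P * Q) ^ 2 ^ k).trace ≤ (P ^ 2 ^ k * Q ^ 2 ^ k).trace :=
  trace_mul_pow_two_pow_le_of_forall (fun j _ => trace_pow_two_pow_succ_le j) P Q hP hQ

theorem trace_mul_nonneg {A B : Matrix ι ι ℝ} (hA : 0 ≤ A) (hB : 0 ≤ B) :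
    0 ≤ (A * B).trace := by
  obtain ⟨C, rfl⟩ := CStarAlgebra.nonneg_iff_eq_star_mul_self.1 hB
  rw [← Matrix.mul_assoc, trace_mul_comm, ← Matrix.mul_assoc]
  exact (nonneg_iff_posSemidef.1 (star_right_conjugate_nonneg hA C)).trace_nonneg

open scoped Matrix.Norms.L2Operator in
/-- The **Golden–Thompson inequality** for real symmetric matrices. -/
theorem trace_exp_add_le [Nonempty ι] {A B : Matrix ι ι ℝ} (hA : A.IsSymm) (hB : B.IsSymm) :
    (NormedSpace.exp (A + B)).trace ≤ (NormedSpace.exp A * NormedSpace.exp B).trace := by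
  have hlim := tendsto_exp_mul_exp_pow A B
  -- The trace inequality covers exponents `2 ^ k` only; the shift by one matches the exponent `n +
  -- 1` in Lie–Trotter.
  have hsub : Filter.Tendsto (fun k : ℕ => 2 ^ k - 1) Filter.atTop Filter.atTop := by
    refine Filter.tendsto_atTop_mono (fun k => ?_) Filter.tendsto_id
    have := k.lt_two_pow_self
    simp only [id]
    omega
  have htr : Continuous (fun M : Matrix ι ι ℝ => M.trace) := continuous_id.matrix_trace
  refine le_of_tendsto ((htr.tendsto _).comp (hlim.comp hsub)) (Filter.Eventually.of_forall ?_)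
  intro k
  have h1 : 2 ^ k - 1 + 1 = 2 ^ k := Nat.sub_add_cancel Nat.one_le_two_pow
  have h2 : (((2 ^ k - 1 : ℕ) : ℝ) + 1) = ((2 ^ k : ℕ) : ℝ) := by exact_mod_cast h1
  have hroot (Z : Matrix ι ι ℝ) :
      NormedSpace.exp ((((2 ^ k : ℕ) : ℝ))⁻¹ • Z) ^ 2 ^ k = NormedSpace.exp Z :=
    exp_inv_natCast_smul_pow (by positivity) Z
  simp only [Function.comp_apply, h1, h2]
  refine (trace_mul_pow_two_pow_le (hA.smul _).exp (hB.smul _).exp k).trans_eq ?_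
  rw [hroot, hroot]

end Trace

end Matrix

/-! ### Exponential moments and matrix Bernstein -/

theorem Real.exp_le_one_add_add_sq {x : ℝ} (hx : |x| ≤ 3 / 7) :
    Real.exp x ≤ 1 + x + 7 / 12 * x ^ 2 := by
  have h := Real.exp_bound (x := x) (n := 4) (by linarith) (by norm_num)
  have h1 := (abs_le.1 h).2
  norm_num [Finset.sum_range_succ, Nat.factorial] at h1
  have hx2 : |x| ^ 2 = x ^ 2 := sq_abs x
  have h3 : x ^ 3 ≤ 3 / 7 * x ^ 2 := by
    have : x ≤ 3 / 7 := (le_abs_self x).trans hx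
    nlinarith [sq_nonneg x]
  have h4 : |x| ^ 4 ≤ 9 / 49 * x ^ 2 := by
    have : |x| ^ 4 = x ^ 2 * x ^ 2 := by rw [← hx2]; ring
    rw [this]
    have : x ^ 2 ≤ 9 / 49 := by rw [← hx2]; nlinarith [abs_nonneg x]
    nlinarith [sq_nonneg x]
  have h4' : x ^ 4 ≤ 9 / 49 * x ^ 2 := by
    rwa [show |x| ^ 4 = x ^ 4 from (by decide : Even 4).pow_abs x] at h4
  nlinarith [sq_nonneg x]

namespace Matrix

theorem smul_le_smul_of_nonneg_left {ι : Type*} {A B : Matrix ι ι ℝ} (h : A ≤ B) {c : ℝ}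
    (hc : 0 ≤ c) : c • A ≤ c • B := by
  rw [le_iff, ← smul_sub]
  exact (le_iff.1 h).smul hc

theorem smul_one_le_smul_one {ι : Type*} [DecidableEq ι] {a b : ℝ} (h : a ≤ b) :
    a • (1 : Matrix ι ι ℝ) ≤ b • (1 : Matrix ι ι ℝ) := by
  rw [le_iff, ← sub_smul]
  exact PosSemidef.one.smul (sub_nonneg.2 h)

theorem trace_mono {ι : Type*} [Fintype ι] {A B : Matrix ι ι ℝ} (h : A ≤ B) :
    A.trace ≤ B.trace := by
  have := (le_iff.1 h).trace_nonneg
  rw [trace_sub] at this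
  linarith

theorem IsHermitian.sum {ι κ : Type*} {s : Finset κ} {U : κ → Matrix ι ι ℝ}
    (hU : ∀ k, (U k).IsHermitian) : (∑ k ∈ s, U k).IsHermitian :=
  isSelfAdjoint_sum s fun k _ => hU k

variable {ι : Type*} [Fintype ι] [DecidableEq ι]

section Exp

open scoped Matrix.Norms.L2Operator

theorem IsHermitian.exp_eq_cfc {S : Matrix ι ι ℝ} (hS : S.IsHermitian) :
    NormedSpace.exp S = cfc Real.exp S :=
  (CFC.real_exp_eq_normedSpace_exp hS.isSelfAdjoint).symm

theorem IsHermitian.exp_nonneg {S : Matrix ι ι ℝ} (hS : S.IsHermitian) :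
    0 ≤ NormedSpace.exp S := by
  rw [hS.exp_eq_cfc]
  exact cfc_nonneg fun x _ => (Real.exp_pos x).le

theorem IsHermitian.trace_exp {S : Matrix ι ι ℝ} (hS : S.IsHermitian) :
    (NormedSpace.exp S).trace = ∑ i, Real.exp (hS.eigenvalues i) := by
  rw [hS.exp_eq_cfc, hS.cfc_eq, IsHermitian.cfc, Unitary.conjStarAlgAut_apply, trace_mul_cycle,
    Unitary.coe_star_mul_self, Matrix.one_mul, trace_diagonal]
  rfl

/-- Some eigenvalue exceeds `s`, and the trace is a sum of positive exponentials. This is the Markov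
step of the Laplace transform method. -/
theorem IsHermitian.exp_le_trace_exp {S : Matrix ι ι ℝ} (hS : S.IsHermitian) {s : ℝ}
    (h : ¬ S ≤ s • (1 : Matrix ι ι ℝ)) : Real.exp s ≤ (NormedSpace.exp S).trace := by
  rw [← Algebra.algebraMap_eq_smul_one, le_algebraMap_iff_spectrum_le hS.isSelfAdjoint,
    hS.spectrum_real_eq_range_eigenvalues] at h
  simp only [Set.mem_range, forall_exists_index, forall_apply_eq_imp_iff, not_forall,
    not_le] at h
  obtain ⟨i, hi⟩ := h
  rw [hS.trace_exp]
  exact (Real.exp_le_exp.2 hi.le).trans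
    (Finset.single_le_sum (f := fun i => Real.exp (hS.eigenvalues i))
      (fun j _ => (Real.exp_pos _).le) (Finset.mem_univ i))

theorem IsHermitian.exp_le_one_add_add_sq {U : Matrix ι ι ℝ} (hU : U.IsHermitian)
    (h1 : U ≤ (3 / 7 : ℝ) • (1 : Matrix ι ι ℝ)) (h2 : (-(3 / 7) : ℝ) • (1 : Matrix ι ι ℝ) ≤ U) :
    NormedSpace.exp U ≤ 1 + U + (7 / 12 : ℝ) • U ^ 2 := by
  have hU' := hU.isSelfAdjoint
  rw [← Algebra.algebraMap_eq_smul_one, le_algebraMap_iff_spectrum_le hU'] at h1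
  rw [← Algebra.algebraMap_eq_smul_one, algebraMap_le_iff_le_spectrum hU'] at h2
  have hq : cfc (fun x : ℝ => 1 + x + 7 / 12 * x ^ 2) U = 1 + U + (7 / 12 : ℝ) • U ^ 2 := by
    rw [cfc_add U (fun x : ℝ => 1 + x) (fun x : ℝ => 7 / 12 * x ^ 2),
      cfc_const_mul (7 / 12 : ℝ) (fun x : ℝ => x ^ 2) U, cfc_pow_id U 2,
      cfc_add U (fun _ : ℝ => 1) (fun x : ℝ => x), cfc_id' ℝ U, cfc_const_one ℝ U]
  rw [hU.exp_eq_cfc, ← hq]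
  exact cfc_mono fun x hx => Real.exp_le_one_add_add_sq (abs_le.2 ⟨h2 x hx, h1 x hx⟩)

end Exp

/-- The linear term averages out, and `1 + y ≤ exp y` absorbs the quadratic one. A bound by a
multiple of the identity is what Golden–Thompson can iterate. -/
theorem sum_exp_le {κ : Type*} [Fintype κ] {U : κ → Matrix ι ι ℝ} (hU : ∀ k, (U k).IsHermitian)
    (h1 : ∀ k, U k ≤ (3 / 7 : ℝ) • (1 : Matrix ι ι ℝ))
    (h2 : ∀ k, (-(3 / 7) : ℝ) • (1 : Matrix ι ι ℝ) ≤ U k) (hmean : ∑ k, U k = 0) {v : ℝ}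
    (hvar : ∑ k, U k ^ 2 ≤ (Fintype.card κ * v) • (1 : Matrix ι ι ℝ)) :
    ∑ k, NormedSpace.exp (U k)
      ≤ (Fintype.card κ * Real.exp (7 / 12 * v)) • (1 : Matrix ι ι ℝ) := by
  calc ∑ k, NormedSpace.exp (U k)
      ≤ ∑ k, (1 + U k + (7 / 12 : ℝ) • U k ^ 2) :=
        Finset.sum_le_sum fun k _ => (hU k).exp_le_one_add_add_sq (h1 k) (h2 k)
    _ = (Fintype.card κ : ℝ) • (1 : Matrix ι ι ℝ) + (7 / 12 : ℝ) • ∑ k, U k ^ 2 := by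
        rw [Finset.sum_add_distrib, Finset.sum_add_distrib, hmean, add_zero, ← Finset.smul_sum,
          Finset.sum_const, Finset.card_univ, Nat.cast_smul_eq_nsmul]
    _ ≤ (Fintype.card κ : ℝ) • (1 : Matrix ι ι ℝ)
          + (7 / 12 : ℝ) • ((Fintype.card κ * v) • (1 : Matrix ι ι ℝ)) := by
        gcongr
    _ = (Fintype.card κ * (7 / 12 * v + 1)) • (1 : Matrix ι ι ℝ) := by
        rw [smul_smul, ← add_smul]; ring_nf
    _ ≤ _ := smul_one_le_smul_one (by gcongr; exact Real.add_one_le_exp _)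

/-- Bound on the trace moment generating function of a sum of independent uniform samples, by
iterating the Golden–Thompson inequality. -/
theorem sum_trace_exp_sum_le [Nonempty ι] {N : ℕ} {U : Fin N → Matrix ι ι ℝ}
    (hU : ∀ k, (U k).IsHermitian) {c : ℝ}
    (hc : ∑ k, NormedSpace.exp (U k) ≤ c • (1 : Matrix ι ι ℝ)) (n : ℕ) :
    ∑ g : Fin n → Fin N, (NormedSpace.exp (∑ i, U (g i))).trace ≤ Fintype.card ι * c ^ n := by
  have hc0 : 0 ≤ c := by
    have h0 : 0 ≤ ∑ k, NormedSpace.exp (U k) := Finset.sum_nonneg fun k _ => (hU k).exp_nonneg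
    have h1 := trace_mono (h0.trans hc)
    rw [trace_zero, trace_smul, trace_one, smul_eq_mul] at h1
    exact nonneg_of_mul_nonneg_left h1 (by exact_mod_cast Fintype.card_pos)
  induction n with
  | zero => simp [NormedSpace.exp_zero]
  | succ n ih =>
    have hS (g : Fin n → Fin N) : (∑ i, U (g i)).IsHermitian := IsHermitian.sum fun i => hU (g i)
    calc ∑ g : Fin (n + 1) → Fin N, (NormedSpace.exp (∑ i, U (g i))).trace
        = ∑ g : Fin n → Fin N, ∑ k, (NormedSpace.exp (U k + ∑ i, U (g i))).trace := by
          rw [← (Fin.consEquiv fun _ => Fin N).sum_comp, Fintype.sum_prod_type, Finset.sum_comm]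
          simp [Fin.consEquiv, Fin.sum_univ_succ]
      _ ≤ ∑ g : Fin n → Fin N, ∑ k,
            (NormedSpace.exp (U k) * NormedSpace.exp (∑ i, U (g i))).trace := by
          gcongr with g _ k _
          exact trace_exp_add_le (isHermitian_iff_isSymm.1 (hU k)) (isHermitian_iff_isSymm.1 (hS g))
      _ = ∑ g : Fin n → Fin N,
            ((∑ k, NormedSpace.exp (U k)) * NormedSpace.exp (∑ i, U (g i))).trace := by
          simp_rw [Finset.sum_mul, trace_sum]
      _ ≤ ∑ g : Fin n → Fin N, c * (NormedSpace.exp (∑ i, U (g i))).trace := by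
          gcongr with g _
          -- The exponential of the remaining sum is positive semidefinite, so the first factor may
          -- be replaced by its upper bound under the trace.
          have h := trace_mul_nonneg (sub_nonneg.2 hc) (hS g).exp_nonneg
          rw [Matrix.sub_mul, trace_sub, Matrix.smul_mul, Matrix.one_mul, trace_smul,
            smul_eq_mul] at h
          linarith
      _ ≤ c * (Fintype.card ι * c ^ n) := by
          rw [← Finset.mul_sum]
          gcongr
      _ = Fintype.card ι * c ^ (n + 1) := by ring

open Classical in
/-- A one-sided matrix Bernstein inequality for sampling with replacement, in counting form. -/
theorem card_not_sum_le_mul_le [Nonempty ι] {N : ℕ} {U : Fin N → Matrix ι ι ℝ}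
    (hU : ∀ k, (U k).IsHermitian)
    (h1 : ∀ k, U k ≤ (3 / 7 : ℝ) • (1 : Matrix ι ι ℝ))
    (h2 : ∀ k, (-(3 / 7) : ℝ) • (1 : Matrix ι ι ℝ) ≤ U k) (hmean : ∑ k, U k = 0) {v : ℝ}
    (hvar : ∑ k, U k ^ 2 ≤ (N * v) • (1 : Matrix ι ι ℝ)) (n : ℕ) (s : ℝ) :
    ((Finset.univ.filter fun g : Fin n → Fin N =>
        ¬ ∑ i, U (g i) ≤ s • (1 : Matrix ι ι ℝ)).card : ℝ)
      ≤ Fintype.card ι * (N : ℝ) ^ n * Real.exp (n * (7 / 12 * v) - s) := by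
  have hS (g : Fin n → Fin N) : (∑ i, U (g i)).IsHermitian := IsHermitian.sum fun i => hU (g i)
  have hmgf := sum_trace_exp_sum_le hU
    (sum_exp_le hU h1 h2 hmean (by rwa [Fintype.card_fin])) n
  rw [Fintype.card_fin, mul_pow, ← Real.exp_nat_mul] at hmgf
  set B := Finset.univ.filter fun g : Fin n → Fin N => ¬ ∑ i, U (g i) ≤ s • (1 : Matrix ι ι ℝ)
  have hB : (B.card : ℝ) * Real.exp s
      ≤ ∑ g : Fin n → Fin N, (NormedSpace.exp (∑ i, U (g i))).trace := by
    calc (B.card : ℝ) * Real.exp s = ∑ _g ∈ B, Real.exp s := by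
          rw [Finset.sum_const, nsmul_eq_mul]
      _ ≤ ∑ g ∈ B, (NormedSpace.exp (∑ i, U (g i))).trace :=
          Finset.sum_le_sum fun g hg => (hS g).exp_le_trace_exp (Finset.mem_filter.1 hg).2
      _ ≤ _ := Finset.sum_le_sum_of_subset_of_nonneg (Finset.subset_univ _)
          fun g _ _ => (nonneg_iff_posSemidef.1 (hS g).exp_nonneg).trace_nonneg
  rw [Real.exp_sub, ← mul_div_assoc, le_div_iff₀ (Real.exp_pos s), mul_assoc]
  exact hB.trans hmgf

end Matrix

/-! ### Whitening and the relative deviation bound -/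

namespace Matrix

variable {ι : Type*} [Fintype ι] [DecidableEq ι]

/-- Conjugate `X ≤ r` by the square root of `X`. This yields a variance bound linear in `r`. -/
theorem sq_le_smul_of_nonneg_of_le {X : Matrix ι ι ℝ} {r : ℝ} (h0 : 0 ≤ X)
    (hr : X ≤ r • (1 : Matrix ι ι ℝ)) : X ^ 2 ≤ r • X := by
  have hS : IsSelfAdjoint (CFC.sqrt X) := (CFC.sqrt_nonneg X).isSelfAdjoint
  have hX : CFC.sqrt X * CFC.sqrt X = X := CFC.sqrt_mul_sqrt_self X
  have h := hS.conjugate_le_conjugate hr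
  have h1 : CFC.sqrt X * X * CFC.sqrt X = X ^ 2 := by
    calc CFC.sqrt X * X * CFC.sqrt X
        = CFC.sqrt X * (CFC.sqrt X * CFC.sqrt X) * CFC.sqrt X := by rw [hX]
      _ = CFC.sqrt X * CFC.sqrt X * (CFC.sqrt X * CFC.sqrt X) := by simp only [Matrix.mul_assoc]
      _ = X ^ 2 := by rw [hX, sq]
  rwa [h1, Matrix.mul_smul, Matrix.mul_one, Matrix.smul_mul, hX] at h

theorem PosDef.exists_isHermitian_conj_eq_one {H : Matrix ι ι ℝ} (hH : H.PosDef) :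
    ∃ W : Matrix ι ι ℝ, W.IsHermitian ∧ W * H * W = 1 := by
  have h0 : 0 ≤ H⁻¹ := nonneg_iff_posSemidef.2 hH.inv.posSemidef
  have hsq : CFC.sqrt H⁻¹ * CFC.sqrt H⁻¹ = H⁻¹ := CFC.sqrt_mul_sqrt_self H⁻¹
  refine ⟨CFC.sqrt H⁻¹, (CFC.sqrt_nonneg H⁻¹).isSelfAdjoint, ?_⟩
  have h1 : CFC.sqrt H⁻¹ * (CFC.sqrt H⁻¹ * H) = 1 := by
    rw [← Matrix.mul_assoc, hsq, nonsing_inv_mul _ ((isUnit_iff_isUnit_det H).1 hH.isUnit)]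
  exact mul_eq_one_comm.1 h1

theorem le_smul_of_conj_le_smul_one {H D W : Matrix ι ι ℝ} (hH : H.IsHermitian)
    (hW : W.IsHermitian) (hWH : W * H * W = 1) {c : ℝ}
    (h : W * D * W ≤ c • (1 : Matrix ι ι ℝ)) : D ≤ c • H := by
  have h1 : H * W * W = 1 := by
    rw [mul_eq_one_comm, ← Matrix.mul_assoc]
    exact hWH
  have h2 : W * (W * H) = 1 := mul_eq_one_comm.1 hWH
  -- Both products are the inverse of `W`, so conjugating by `W * H` undoes the whitening.
  have hcomm : H * W = W * H := left_inv_eq_right_inv h1 h2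
  have hstar : star (W * H) = H * W := by
    rw [star_mul, star_eq_conjTranspose, star_eq_conjTranspose, hH.eq, hW.eq]
  have h3 := star_right_conjugate_le_conjugate h (W * H)
  have h4 : W * H * (W * D * W) * (H * W) = D := by
    calc W * H * (W * D * W) * (H * W) = (W * H * W) * D * (W * H * W) := by
          simp only [Matrix.mul_assoc]
      _ = D := by rw [hWH, Matrix.one_mul, Matrix.mul_one]
  have h5 : W * H * (H * W) = H := by
    rw [← hcomm, Matrix.mul_assoc, ← Matrix.mul_assoc W, hWH, Matrix.mul_one]
  rwa [hstar, h4, Matrix.mul_smul, Matrix.smul_mul, Matrix.mul_one, h5] at h3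

open Classical in
/-- Matrix Bernstein inequality for the empirical mean of positive semidefinite matrices `X k ≤ r`
whose mean is at most `1`; `ε = ±1` selects the tail. -/
theorem card_not_mean_deviation_le [Nonempty ι] {N : ℕ} (hN : N ≠ 0) {X : Fin N → Matrix ι ι ℝ}
    {r : ℝ} (hr : 0 < r) (h0 : ∀ k, 0 ≤ X k) (hX : ∀ k, X k ≤ r • (1 : Matrix ι ι ℝ))
    {M : Matrix ι ι ℝ} (hM : ∑ k, X k = (N : ℝ) • M) (hM1 : M ≤ 1) {n : ℕ} (hn : n ≠ 0)
    {ε : ℝ} (hε : ε = 1 ∨ ε = -1) :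
    ((Finset.univ.filter fun g : Fin n → Fin N =>
        ¬ ε • ((n : ℝ)⁻¹ • ∑ i, X (g i) - M) ≤ (1 / 2 : ℝ) • (1 : Matrix ι ι ℝ)).card : ℝ)
      ≤ Fintype.card ι * (N : ℝ) ^ n * Real.exp (-(3 * n / (28 * r))) := by
  have hN' : (0 : ℝ) < N := by exact_mod_cast Nat.pos_of_ne_zero hN
  have hn' : (0 : ℝ) < n := by exact_mod_cast Nat.pos_of_ne_zero hn
  have hMeq : M = (N : ℝ)⁻¹ • ∑ k, X k := by
    rw [hM, smul_smul, inv_mul_cancel₀ hN'.ne', one_smul]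
  have hM0 : 0 ≤ M := by
    rw [hMeq, ← smul_zero (N : ℝ)⁻¹]
    exact smul_le_smul_of_nonneg_left (Finset.sum_nonneg fun k _ => h0 k) (by positivity)
  have hMr : M ≤ r • (1 : Matrix ι ι ℝ) := by
    calc M = (N : ℝ)⁻¹ • ∑ k, X k := hMeq
      _ ≤ (N : ℝ)⁻¹ • ∑ _k : Fin N, r • (1 : Matrix ι ι ℝ) :=
          smul_le_smul_of_nonneg_left (Finset.sum_le_sum fun k _ => hX k) (by positivity)
      _ = r • (1 : Matrix ι ι ℝ) := by
          rw [Finset.sum_const, Finset.card_univ, Fintype.card_fin, ← Nat.cast_smul_eq_nsmul ℝ,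
            smul_smul, inv_mul_cancel₀ hN'.ne', one_smul]
  have hYu (k) : X k - M ≤ r • (1 : Matrix ι ι ℝ) := (sub_le_self _ hM0).trans (hX k)
  have hYl (k) : M - X k ≤ r • (1 : Matrix ι ι ℝ) := (sub_le_self _ (h0 k)).trans hMr
  -- This minimises the exponent `7/12 θ² r - θ/2` per sample, with value `-3/(28r)`, and makes `θr
  -- = 3/7`, the limit of validity of the quadratic bound on `exp`.
  set θ : ℝ := 3 / (7 * r) with hθ
  have hθ0 : 0 < θ := by positivity
  have hθr : θ * r = 3 / 7 := by rw [hθ]; field_simp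
  have hεsq : ε ^ 2 = 1 := by rcases hε with rfl | rfl <;> norm_num
  let U : Fin N → Matrix ι ι ℝ := fun k => θ • ε • (X k - M)
  have hU (k) : (U k).IsHermitian := by
    have h : (X k - M).IsHermitian :=
      (nonneg_iff_posSemidef.1 (h0 k)).isHermitian.sub (nonneg_iff_posSemidef.1 hM0).isHermitian
    exact (h.smul (star_trivial ε)).smul (star_trivial θ)
  have hεu (k) : ε • (X k - M) ≤ r • (1 : Matrix ι ι ℝ) := by
    rcases hε with rfl | rfl
    · simpa using hYu k
    · simpa using hYl k
  have hεl (k) : -(ε • (X k - M)) ≤ r • (1 : Matrix ι ι ℝ) := by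
    rcases hε with rfl | rfl
    · simpa using hYl k
    · simpa using hYu k
  have h1 (k) : U k ≤ (3 / 7 : ℝ) • (1 : Matrix ι ι ℝ) := by
    rw [← hθr, mul_smul]
    exact smul_le_smul_of_nonneg_left (hεu k) hθ0.le
  have h2 (k) : (-(3 / 7) : ℝ) • (1 : Matrix ι ι ℝ) ≤ U k := by
    rw [neg_smul, neg_le, ← hθr, mul_smul, ← smul_neg]
    exact smul_le_smul_of_nonneg_left (hεl k) hθ0.le
  have hsum0 : ∑ k, (X k - M) = 0 := by
    rw [Finset.sum_sub_distrib, hM, Finset.sum_const, Finset.card_univ, Fintype.card_fin,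
      Nat.cast_smul_eq_nsmul, sub_self]
  have hmean : ∑ k, U k = 0 := by
    simp only [U, ← Finset.smul_sum, hsum0, smul_zero]
  have hsq : ∑ k, (X k - M) ^ 2 ≤ (N * r) • (1 : Matrix ι ι ℝ) := by
    have hexp : ∑ k, (X k - M) ^ 2 = ∑ k, X k ^ 2 - (N : ℝ) • M ^ 2 := by
      have : ∀ k, (X k - M) ^ 2 = X k ^ 2 - X k * M - M * (X k - M) := fun k => by
        rw [sq, sq]; noncomm_ring
      simp only [this, Finset.sum_sub_distrib, ← Finset.sum_mul, ← Finset.mul_sum, hsum0, hM]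
      rw [Matrix.mul_zero, sub_zero, Matrix.smul_mul, sq]
    have hMM : 0 ≤ M ^ 2 := by
      rw [sq]
      nth_rewrite 1 [← (IsSelfAdjoint.of_nonneg hM0).star_eq]
      exact star_mul_self_nonneg M
    calc ∑ k, (X k - M) ^ 2 = ∑ k, X k ^ 2 - (N : ℝ) • M ^ 2 := hexp
      _ ≤ ∑ k, X k ^ 2 := sub_le_self _ (by
          simpa using smul_le_smul_of_nonneg_left hMM hN'.le)
      _ ≤ ∑ k, r • X k := Finset.sum_le_sum fun k _ => sq_le_smul_of_nonneg_of_le (h0 k) (hX k)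
      _ = (N * r) • M := by rw [← Finset.smul_sum, hM, smul_smul, mul_comm]
      _ ≤ (N * r) • (1 : Matrix ι ι ℝ) := smul_le_smul_of_nonneg_left hM1 (by positivity)
  have hvar : ∑ k, U k ^ 2 ≤ (N * (θ ^ 2 * r)) • (1 : Matrix ι ι ℝ) := by
    calc ∑ k, U k ^ 2 = θ ^ 2 • ∑ k, (X k - M) ^ 2 := by
          simp only [U, smul_pow, hεsq, one_smul, Finset.smul_sum]
      _ ≤ θ ^ 2 • ((N * r) • (1 : Matrix ι ι ℝ)) :=
          smul_le_smul_of_nonneg_left hsq (by positivity)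
      _ = _ := by rw [smul_smul]; ring_nf
  have hmain := card_not_sum_le_mul_le hU h1 h2 hmean hvar n (θ * n * (1 / 2))
  have hexponent : n * (7 / 12 * (θ ^ 2 * r)) - θ * n * (1 / 2) = -(3 * n / (28 * r)) := by
    rw [hθ]; field_simp; norm_num
  rw [hexponent] at hmain
  refine le_trans ?_ hmain
  refine Nat.cast_le.2 (Finset.card_le_card fun g hg => ?_)
  simp only [Finset.mem_filter, Finset.mem_univ, true_and] at hg ⊢
  refine fun hcontra => hg ?_
  have hsumU : ∑ i, U (g i) = (θ * n) • ε • ((n : ℝ)⁻¹ • ∑ i, X (g i) - M) := by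
    simp only [U, ← Finset.smul_sum, Finset.sum_sub_distrib]
    rw [Finset.sum_const, Finset.card_univ, Fintype.card_fin, ← Nat.cast_smul_eq_nsmul ℝ,
      mul_smul, smul_comm (n : ℝ) ε, smul_sub (n : ℝ), smul_smul (n : ℝ), mul_inv_cancel₀ hn'.ne',
      one_smul]
  have h := smul_le_smul_of_nonneg_left hcontra (c := (θ * n)⁻¹) (by positivity)
  have hθn : θ * n ≠ 0 := by positivity
  rwa [hsumU, inv_smul_smul₀ hθn, smul_smul, ← mul_assoc, inv_mul_cancel₀ hθn, one_mul] at h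

open Classical in
/-- Relative deviation bound, in counting form: except for a small proportion of the samples `g`,
the empirical mean of `A` deviates from its mean `S` by at most half of `S + β • 1`. -/
theorem card_not_relative_deviation_le [Nonempty ι] {N : ℕ} (hN : N ≠ 0)
    {A : Fin N → Matrix ι ι ℝ} {r β : ℝ} (hr : 0 < r) (hβ : 0 < β) (h0 : ∀ k, 0 ≤ A k)
    (hA : ∀ k, A k ≤ (β * r) • (1 : Matrix ι ι ℝ)) {S : Matrix ι ι ℝ}
    (hS : ∑ k, A k = (N : ℝ) • S) {n : ℕ} (hn : n ≠ 0) {ε : ℝ} (hε : ε = 1 ∨ ε = -1) :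
    ((Finset.univ.filter fun g : Fin n → Fin N =>
        ¬ ε • ((n : ℝ)⁻¹ • ∑ i, A (g i) - S) ≤ (1 / 2 : ℝ) • (S + β • 1)).card : ℝ)
      ≤ Fintype.card ι * (N : ℝ) ^ n * Real.exp (-(3 * n / (28 * r))) := by
  have hN' : (0 : ℝ) < N := by exact_mod_cast Nat.pos_of_ne_zero hN
  have hS0 : 0 ≤ S := by
    have h : S = (N : ℝ)⁻¹ • ∑ k, A k := by
      rw [hS, smul_smul, inv_mul_cancel₀ hN'.ne', one_smul]
    rw [h, ← smul_zero (N : ℝ)⁻¹]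
    exact smul_le_smul_of_nonneg_left (Finset.sum_nonneg fun k _ => h0 k) (by positivity)
  have hH : (S + β • (1 : Matrix ι ι ℝ)).PosDef :=
    PosDef.posSemidef_add (nonneg_iff_posSemidef.1 hS0) (PosDef.one.smul hβ)
  -- Since `S` and `βI` are each at most `S + βI`, conjugation by `W` brings both below the
  -- identity; the first bounds the mean, the second the summands.
  obtain ⟨W, hW, hWH⟩ := hH.exists_isHermitian_conj_eq_one
  have hWs : IsSelfAdjoint W := hW
  have hβW : W * (β • 1) * W ≤ 1 := by
    have h : β • (1 : Matrix ι ι ℝ) ≤ S + β • 1 := le_add_of_nonneg_left hS0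
    exact (hWs.conjugate_le_conjugate h).trans_eq hWH
  have hX0 (k) : 0 ≤ W * A k * W := hWs.conjugate_nonneg (h0 k)
  have hXr (k) : W * A k * W ≤ r • (1 : Matrix ι ι ℝ) := by
    refine (hWs.conjugate_le_conjugate (hA k)).trans ?_
    have h := smul_le_smul_of_nonneg_left hβW hr.le
    rwa [← Matrix.smul_mul, ← Matrix.mul_smul, smul_smul, mul_comm r β] at h
  have hXM : ∑ k, W * A k * W = (N : ℝ) • (W * S * W) := by
    rw [← Finset.sum_mul, ← Finset.mul_sum, hS, Matrix.mul_smul, Matrix.smul_mul]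
  have hM1 : W * S * W ≤ 1 := by
    have hβ1 : 0 ≤ β • (1 : Matrix ι ι ℝ) := nonneg_iff_posSemidef.2 (PosSemidef.one.smul hβ.le)
    have h : S ≤ S + β • (1 : Matrix ι ι ℝ) := le_add_of_nonneg_right hβ1
    exact (hWs.conjugate_le_conjugate h).trans_eq hWH
  have hmain := card_not_mean_deviation_le hN hr hX0 hXr hXM hM1 hn hε
  refine le_trans ?_ hmain
  refine Nat.cast_le.2 (Finset.card_le_card fun g hg => ?_)
  simp only [Finset.mem_filter, Finset.mem_univ, true_and] at hg ⊢
  refine fun hcontra => hg ?_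
  refine le_smul_of_conj_le_smul_one hH.isHermitian hW hWH ?_
  rw [← Finset.sum_mul, ← Finset.mul_sum] at hcontra
  rwa [Matrix.mul_smul, Matrix.smul_mul, Matrix.mul_sub, Matrix.sub_mul, Matrix.mul_smul,
    Matrix.smul_mul]

theorem vecMulVec_self_nonneg {ι : Type*} [Finite ι] (a : ι → ℝ) : 0 ≤ vecMulVec a a := by
  simpa using nonneg_iff_posSemidef.2 (posSemidef_vecMulVec_self_star a)

theorem vecMulVec_self_le_smul_one {a : ι → ℝ} {c : ℝ} (h : a ⬝ᵥ a ≤ c) :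
    vecMulVec a a ≤ c • (1 : Matrix ι ι ℝ) := by
  rw [le_iff]
  refine PosSemidef.of_dotProduct_mulVec_nonneg ?_ fun x => ?_
  · exact (PosSemidef.one.isHermitian.smul (star_trivial c)).sub
      (nonneg_iff_posSemidef.1 (vecMulVec_self_nonneg a)).isHermitian
  · have hcs : (a ⬝ᵥ x) ^ 2 ≤ (a ⬝ᵥ a) * (x ⬝ᵥ x) := by
      simpa [dotProduct, sq] using Finset.sum_mul_sq_le_sq_mul_sq Finset.univ a x
    have hx : 0 ≤ x ⬝ᵥ x := by simpa using dotProduct_star_self_nonneg x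
    rw [star_trivial, sub_mulVec, dotProduct_sub, smul_mulVec, one_mulVec, dotProduct_smul,
      vecMulVec_mulVec, smul_eq_mul]
    simp only [dotProduct_smul, MulOpposite.smul_eq_mul_unop, MulOpposite.unop_op,
      dotProduct_comm x a]
    nlinarith

end Matrix

/-! ### Derivatives and convexity of the quadratic risks -/

section QuadraticRisk

variable {d k : ℕ} {lam : ℝ} {z : Fin k → EuclideanSpace ℝ (Fin d) × ℝ} {μ : ℝ}

/-- Allows a single Hessian computation to serve `F`, `f` and `φ`. -/
theorem referenceFun_zero (f : EuclideanSpace ℝ (Fin d) → ℝ) : referenceFun f 0 = f := by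
  ext x; simp [referenceFun]

theorem contDiff_referenceFun_empiricalRisk :
    ContDiff ℝ 2 (referenceFun (empiricalRisk lam z) μ) := by
  unfold referenceFun empiricalRisk quadLoss
  have h : ContDiff ℝ 2 fun x : EuclideanSpace ℝ (Fin d) => ‖x‖ ^ 2 := contDiff_norm_sq ℝ
  have hin (a : EuclideanSpace ℝ (Fin d)) :
      ContDiff ℝ 2 fun x : EuclideanSpace ℝ (Fin d) => inner ℝ a x := (innerSL ℝ a).contDiff
  fun_prop

theorem twiceDifferentiable_referenceFun_empiricalRisk :
    TwiceDifferentiable (referenceFun (empiricalRisk lam z) μ) :=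
  ⟨contDiff_referenceFun_empiricalRisk.differentiable two_ne_zero,
    (contDiff_referenceFun_empiricalRisk.fderiv_right (m := 1) le_rfl).differentiable one_ne_zero⟩

theorem fderiv_referenceFun_empiricalRisk_apply (x v : EuclideanSpace ℝ (Fin d)) :
    fderiv ℝ (referenceFun (empiricalRisk lam z) μ) x v
      = (1 / (k : ℝ)) * ∑ i, ((inner ℝ (z i).1 x - (z i).2) * inner ℝ (z i).1 v
          + lam * inner ℝ x v) + μ * inner ℝ x v := by
  have hsq : HasFDerivAt (fun y : EuclideanSpace ℝ (Fin d) => ‖y‖ ^ 2) (2 • innerSL ℝ x) x :=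
    (hasStrictFDerivAt_norm_sq x).hasFDerivAt
  have hin (a : EuclideanSpace ℝ (Fin d)) :
      HasFDerivAt (fun y : EuclideanSpace ℝ (Fin d) => inner ℝ a y) (innerSL ℝ a) x :=
    (innerSL ℝ a).hasFDerivAt
  have hloss (i : Fin k) : HasFDerivAt (fun y => quadLoss lam y (z i))
      ((inner ℝ (z i).1 x - (z i).2) • innerSL ℝ (z i).1 + lam • innerSL ℝ x) x := by
    have h := ((((hin (z i).1).sub_const (z i).2).pow 2).mul_const (1 / 2)).add
      (hsq.const_mul (lam / 2))
    refine (h.congr_of_eventuallyEq (.of_forall fun y => ?_)).congr_fderiv ?_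
    · simp [quadLoss, div_eq_mul_inv]
    · ext w
      simp
      ring
  have h : HasFDerivAt (referenceFun (empiricalRisk lam z) μ) _ x :=
    ((HasFDerivAt.fun_sum (u := Finset.univ) fun i _ => hloss i).const_mul
      (1 / (k : ℝ))).add (hsq.const_mul (μ / 2))
  rw [h.fderiv]
  simp
  ring

theorem hessian_referenceFun_empiricalRisk (hk : k ≠ 0) (x : EuclideanSpace ℝ (Fin d)) :
    hessian (referenceFun (empiricalRisk lam z) μ) x
      = (k : ℝ)⁻¹ • ∑ i, Matrix.vecMulVec (z i).1.ofLp (z i).1.ofLp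
        + (lam + μ) • (1 : Matrix (Fin d) (Fin d) ℝ) := by
  ext p q
  set u : EuclideanSpace ℝ (Fin d) := EuclideanSpace.single p 1
  set v : EuclideanSpace ℝ (Fin d) := EuclideanSpace.single q 1
  have hdiff := twiceDifferentiable_referenceFun_empiricalRisk (lam := lam) (z := z) (μ := μ) |>.2 x
  have happ : fderiv ℝ (fun y => fderiv ℝ (referenceFun (empiricalRisk lam z) μ) y v) x u
      = fderiv ℝ (fderiv ℝ (referenceFun (empiricalRisk lam z) μ)) x u v := by
    rw [fderiv_clm_apply hdiff (differentiableAt_const v)]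
    simp
  have hin (a : EuclideanSpace ℝ (Fin d)) :
      HasFDerivAt (fun y : EuclideanSpace ℝ (Fin d) => inner ℝ a y) (innerSL ℝ a) x :=
    (innerSL ℝ a).hasFDerivAt
  have hterm (i : Fin k) := ((((hin (z i).1).sub_const (z i).2).mul_const (inner ℝ (z i).1 v))).add
    ((hin v).const_mul lam)
  have h := ((HasFDerivAt.fun_sum (u := Finset.univ) fun i _ => hterm i).const_mul
    (1 / (k : ℝ))).add ((hin v).const_mul μ)
  have hfun (y : EuclideanSpace ℝ (Fin d)) :
      fderiv ℝ (referenceFun (empiricalRisk lam z) μ) y v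
        = (1 / (k : ℝ)) * ∑ i, ((inner ℝ (z i).1 y - (z i).2) * inner ℝ (z i).1 v
          + lam * inner ℝ v y) + μ * inner ℝ v y := by
    rw [fderiv_referenceFun_empiricalRisk_apply, real_inner_comm y v]
  have hval := (h.congr_of_eventuallyEq (.of_forall hfun)).fderiv
  have huv : inner ℝ v u = (1 : Matrix (Fin d) (Fin d) ℝ) p q := by
    simp [u, v, Matrix.one_apply, EuclideanSpace.inner_single_left, eq_comm]
  have hentry : hessian (referenceFun (empiricalRisk lam z) μ) x p q
      = fderiv ℝ (fun y => fderiv ℝ (referenceFun (empiricalRisk lam z) μ) y v) x u := happ.symm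
  have hk' : (k : ℝ) ≠ 0 := by exact_mod_cast hk
  rw [hentry, hval]
  simp [huv, Matrix.sum_apply, Matrix.vecMulVec_apply, u, v, Finset.sum_add_distrib,
    EuclideanSpace.inner_single_right]
  field_simp
  simp [mul_comm]
  ring

theorem convexOn_referenceFun_empiricalRisk (hlam : 0 ≤ lam) (hμ : 0 ≤ μ) :
    ConvexOn ℝ Set.univ (referenceFun (empiricalRisk lam z) μ) := by
  have hsq : ConvexOn ℝ Set.univ fun x : EuclideanSpace ℝ (Fin d) => ‖x‖ ^ 2 :=
    (convexOn_univ_norm).pow (fun _ _ => norm_nonneg _) 2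
  have hloss (i : Fin k) : ConvexOn ℝ Set.univ fun x => quadLoss lam x (z i) := by
    have h : ConvexOn ℝ Set.univ
        fun x : EuclideanSpace ℝ (Fin d) => (inner ℝ (z i).1 x - (z i).2) ^ 2 :=
      (even_two.convexOn_pow (𝕜 := ℝ)).comp_affineMap
        ((innerSL ℝ (z i).1).toLinearMap.toAffineMap
          - AffineMap.const ℝ (EuclideanSpace ℝ (Fin d)) (z i).2)
    refine ((h.smul (c := 1 / 2) (by norm_num)).add (hsq.smul (c := lam / 2) (by positivity))).congr
      fun x _ => ?_
    simp [quadLoss]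
    ring
  have hsum (t : Finset (Fin k)) : ConvexOn ℝ Set.univ fun x => ∑ i ∈ t, quadLoss lam x (z i) := by
    induction t using Finset.cons_induction with
    | empty => simpa using convexOn_const (0 : ℝ) convex_univ
    | cons i t hi ih =>
      simp only [Finset.sum_cons]
      exact (hloss i).add ih
  exact ((hsum Finset.univ).smul (c := 1 / (k : ℝ)) (by positivity)).add
    (hsq.smul (c := μ / 2) (by positivity))

end QuadraticRisk

/-! ### From counting index tuples to probabilities -/

section UniformSample

variable {Ω : Type*} [MeasurableSpace Ω] {P : Measure Ω} {n N : ℕ} {idx : Fin n → Ω → Fin N}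

theorem IsUniformSample.measure_eq (h : IsUniformSample P idx) (g : Fin n → Fin N) :
    P {ω | (fun i => idx i ω) = g} = ((N : ℝ≥0∞)⁻¹) ^ n := by
  have hset : {ω | (fun i => idx i ω) = g} = ⋂ i, {ω | idx i ω = g i} := by
    ext ω; simp [funext_iff]
  have hind : P (⋂ i, {ω | idx i ω = g i}) = ∏ i, P {ω | idx i ω = g i} :=
    h.indep.meas_iInter fun i => ⟨{g i}, measurableSet_singleton _, rfl⟩
  rw [hset, hind]
  simp [h.uniform]

theorem IsUniformSample.measure_mem_le (h : IsUniformSample P idx) (B : Finset (Fin n → Fin N)) :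
    P {ω | (fun i => idx i ω) ∈ B} ≤ B.card * ((N : ℝ≥0∞)⁻¹) ^ n := by
  have hset : {ω | (fun i => idx i ω) ∈ B} = ⋃ g ∈ B, {ω | (fun i => idx i ω) = g} := by
    ext ω; simp
  rw [hset]
  refine (measure_biUnion_finset_le B _).trans_eq ?_
  simp [h.measure_eq]

theorem IsUniformSample.measure_mem_le_ofReal (h : IsUniformSample P idx) (hN : N ≠ 0)
    {B : Finset (Fin n → Fin N)} {p : ℝ} (hB : (B.card : ℝ) ≤ p * (N : ℝ) ^ n) :
    P {ω | (fun i => idx i ω) ∈ B} ≤ ENNReal.ofReal p := by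
  have hN' : (0 : ℝ) < N := by exact_mod_cast Nat.pos_of_ne_zero hN
  refine (h.measure_mem_le B).trans ?_
  rw [← ENNReal.ofReal_natCast B.card, ← ENNReal.ofReal_natCast N, ← ENNReal.ofReal_inv_of_pos hN',
    ← ENNReal.ofReal_pow (by positivity), ← ENNReal.ofReal_mul (by positivity)]
  refine ENNReal.ofReal_le_ofReal ?_
  rwa [inv_pow, ← div_eq_mul_inv, div_le_iff₀ (by positivity)]

end UniformSample

/-! ### From the deviation bound to the Loewner bounds and the theorem -/

namespace Matrix

variable {ι : Type*} [DecidableEq ι] {S T : Matrix ι ι ℝ} {lam μ : ℝ}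

theorem add_smul_one_le_two_smul_of_deviation
    (h : S - T ≤ (1 / 2 : ℝ) • (S + (lam + 2 * μ) • 1)) :
    S + lam • 1 ≤ (2 : ℝ) • (T + lam • 1 + μ • 1) := by
  have h2 := (le_iff.1 h).smul (zero_le_two (α := ℝ))
  rw [le_iff]
  convert h2 using 1
  module

theorem inv_smul_le_add_smul_one_of_deviation (hlam : 0 < lam) (hμ : 0 ≤ μ) (hS : 0 ≤ S)
    (h : T - S ≤ (1 / 2 : ℝ) • (S + (lam + 2 * μ) • 1)) :
    (3 / 2 + 2 * μ / lam)⁻¹ • (T + lam • 1 + μ • 1) ≤ S + lam • 1 := by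
  have hc : 0 < 3 / 2 + 2 * μ / lam := by positivity
  -- The deviation bound gives `3/2 S + (3/2 λ + 2μ)I`; adding `(2μ/λ)S ≥ 0` makes this a multiple
  -- of `S + λI`.
  have h1 : T + lam • 1 + μ • 1 ≤ (3 / 2 + 2 * μ / lam) • (S + lam • 1) := by
    have h2 := (le_iff.1 h).add
      ((nonneg_iff_posSemidef.1 hS).smul (show 0 ≤ 2 * μ / lam by positivity))
    rw [le_iff]
    convert h2 using 1
    have h3 : (3 / 2 + 2 * μ / lam) • (S + lam • (1 : Matrix ι ι ℝ))
        = (3 / 2 + 2 * μ / lam) • S + (3 / 2 * lam + 2 * μ) • 1 := by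
      rw [smul_add, smul_smul, add_mul, div_mul_cancel₀ _ hlam.ne']
    rw [h3]
    module
  have h2 := smul_le_smul_of_nonneg_left h1 (inv_pos.2 hc).le
  rwa [inv_smul_smul₀ hc.ne'] at h2

end Matrix

theorem relSmoothStronglyConvex_of_hessian_le {d N n : ℕ} {lam μ L σ : ℝ} (hn : n ≠ 0)
    (hlam : 0 ≤ lam) (hμ : 0 ≤ μ) {z : Fin N → EuclideanSpace ℝ (Fin d) × ℝ}
    {w : Fin n → EuclideanSpace ℝ (Fin d) × ℝ}
    (h : ∀ x, σ • (hessian (empiricalRisk lam w) x + μ • 1) ≤ hessian (empiricalRisk lam z) x ∧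
      hessian (empiricalRisk lam z) x ≤ L • (hessian (empiricalRisk lam w) x + μ • 1)) :
    RelSmoothStronglyConvex (empiricalRisk lam z) (referenceFun (empiricalRisk lam w) μ) L σ := by
  have hφ (x) : hessian (referenceFun (empiricalRisk lam w) μ) x
      = hessian (empiricalRisk lam w) x + μ • 1 := by
    rw [← referenceFun_zero (empiricalRisk lam w), hessian_referenceFun_empiricalRisk hn,
      referenceFun_zero, hessian_referenceFun_empiricalRisk hn, add_zero, add_smul, add_assoc]
  refine ⟨convexOn_referenceFun_empiricalRisk hlam hμ,
    twiceDifferentiable_referenceFun_empiricalRisk, ?_, fun x => ?_, fun x => ?_⟩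
  · rw [← referenceFun_zero (empiricalRisk lam z)]
    exact twiceDifferentiable_referenceFun_empiricalRisk
  · rw [hφ]; exact (h x).1
  · rw [hφ]; exact (h x).2

theorem two_div_inv_precondMu_le {d n : ℕ} {R lam δ : ℝ} (hlam : 0 < lam)
    (hlog : 0 ≤ Real.log (2 * d / δ)) :
    2 / (3 / 2 + 2 * precondMu d n R lam δ / lam)⁻¹
      ≤ 3 + 56 / 3 * (R ^ 2 / lam / n * Real.log (2 * d / δ)) := by
  set L := Real.log (2 * d / δ)
  have hnn : 0 ≤ 28 * R ^ 2 / (3 * n) * L := by positivity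
  have hmax : max (28 * R ^ 2 / (3 * n) * L - lam) 0 ≤ 28 * R ^ 2 / (3 * n) * L :=
    max_le (by linarith) hnn
  have hdiv := div_le_div_of_nonneg_right hmax hlam.le
  have heq : 28 * R ^ 2 / (3 * n) * L / lam = 28 / 3 * (R ^ 2 / lam / n * L) := by
    field_simp
  rw [heq] at hdiv
  have hval : 2 / (3 / 2 + 2 * precondMu d n R lam δ / lam)⁻¹
      = 3 + 2 * (max (28 * R ^ 2 / (3 * n) * L - lam) 0 / lam) := by
    rw [div_inv_eq_mul, precondMu]
    ring
  rw [hval]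
  linarith

/-- With probability at least `1 - δ` the preconditioned Hessian of the subsampled risk is spectrally
equivalent to the Hessian of the full risk. -/
theorem ofReal_le_measure_hessian_le {d n N : ℕ} (hd : 0 < d) {R lam δ : ℝ} (hlam : 0 < lam)
    (hδ : 0 < δ) {z : Fin N → EuclideanSpace ℝ (Fin d) × ℝ} (hR : ∀ i, ‖(z i).1‖ ≤ R)
    (hn : n ≠ 0) (hN : N ≠ 0) (hlog : 0 < Real.log (2 * d / δ))
    {Ω : Type*} [MeasurableSpace Ω] {P : Measure Ω} [IsProbabilityMeasure P]
    {idx : Fin n → Ω → Fin N} (hidx : IsUniformSample P idx) :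
    ENNReal.ofReal (1 - δ) ≤ P {ω | ∀ x,
      (3 / 2 + 2 * precondMu d n R lam δ / lam)⁻¹ •
          (hessian (empiricalRisk lam fun i => z (idx i ω)) x + precondMu d n R lam δ • 1)
        ≤ hessian (empiricalRisk lam z) x ∧
      hessian (empiricalRisk lam z) x
        ≤ (2 : ℝ) • (hessian (empiricalRisk lam fun i => z (idx i ω)) x
            + precondMu d n R lam δ • 1)} := by
  classical
  have : Nonempty (Fin d) := ⟨⟨0, hd⟩⟩
  have hn' : (0 : ℝ) < n := by exact_mod_cast Nat.pos_of_ne_zero hn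
  have hN' : (0 : ℝ) < N := by exact_mod_cast Nat.pos_of_ne_zero hN
  have hd' : (0 : ℝ) < d := by exact_mod_cast hd
  set L := Real.log (2 * d / δ) with hL
  set μ := precondMu d n R lam δ with hμdef
  have hμ : 0 ≤ μ := by rw [hμdef, precondMu]; positivity
  -- Chosen so that `d exp(-3n/(28r)) = δ/2`, one half of the failure probability for each tail.
  let r : ℝ := 3 * n / (28 * L)
  have hr : 0 < r := by positivity
  have hβR : R ^ 2 ≤ (lam + 2 * μ) * r := by
    have h1 : 28 * R ^ 2 / (3 * n) * L ≤ lam + 2 * μ := by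
      have := le_max_left (28 * R ^ 2 / (3 * n) * L - lam) 0
      rw [hμdef, precondMu, ← hL]
      linarith
    calc R ^ 2 = 28 * R ^ 2 / (3 * n) * L * r := by simp only [r]; field_simp
      _ ≤ _ := by gcongr
  let A : Fin N → Matrix (Fin d) (Fin d) ℝ := fun k => Matrix.vecMulVec (z k).1.ofLp (z k).1.ofLp
  let S : Matrix (Fin d) (Fin d) ℝ := (N : ℝ)⁻¹ • ∑ k, A k
  have hA0 (k) : 0 ≤ A k := Matrix.vecMulVec_self_nonneg _
  have hA (k) : A k ≤ ((lam + 2 * μ) * r) • (1 : Matrix (Fin d) (Fin d) ℝ) := by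
    refine Matrix.vecMulVec_self_le_smul_one ?_
    have h : (z k).1.ofLp ⬝ᵥ (z k).1.ofLp = ‖(z k).1‖ ^ 2 := by
      rw [EuclideanSpace.real_norm_sq_eq]
      simp [dotProduct, sq]
    rw [h]
    exact (pow_le_pow_left₀ (norm_nonneg _) (hR k) 2).trans hβR
  have hS : ∑ k, A k = (N : ℝ) • S := by
    simp only [S]; rw [smul_smul, mul_inv_cancel₀ hN'.ne', one_smul]
  have hS0 : 0 ≤ S := by
    have hsum : 0 ≤ ∑ k, A k := Finset.sum_nonneg fun k _ => hA0 k
    have h := Matrix.smul_le_smul_of_nonneg_left hsum (inv_pos.2 hN').le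
    rwa [smul_zero] at h
  let T (g : Fin n → Fin N) : Matrix (Fin d) (Fin d) ℝ := (n : ℝ)⁻¹ • ∑ i, A (g i)
  let B (ε : ℝ) : Finset (Fin n → Fin N) := Finset.univ.filter fun g =>
    ¬ ε • (T g - S) ≤ (1 / 2 : ℝ) • (S + (lam + 2 * μ) • 1)
  have hexp : Real.exp (-(3 * n / (28 * r))) = δ / (2 * d) := by
    have h : 3 * n / (28 * r) = L := by simp only [r]; field_simp
    rw [h, Real.exp_neg, hL, Real.exp_log (by positivity), inv_div]
  have hB {ε : ℝ} (hε : ε = 1 ∨ ε = -1) :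
      P {ω | (fun i => idx i ω) ∈ B ε} ≤ ENNReal.ofReal (δ / 2) := by
    refine hidx.measure_mem_le_ofReal hN ?_
    have h := Matrix.card_not_relative_deviation_le hN hr (by positivity) hA0 hA hS hn hε
    rw [hexp, Fintype.card_fin] at h
    refine h.trans_eq ?_
    field_simp
  set G : Set Ω := _
  change ENNReal.ofReal (1 - δ) ≤ P G
  have hcompl : Gᶜ ⊆ {ω | (fun i => idx i ω) ∈ B 1} ∪ {ω | (fun i => idx i ω) ∈ B (-1)} := by
    intro ω hω
    by_contra hcon
    refine hω fun x => ?_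
    simp only [Set.mem_union, Set.mem_ofPred_eq, B, Finset.mem_filter, Finset.mem_univ, true_and,
      not_or, not_not] at hcon
    obtain ⟨h1, h2⟩ := hcon
    rw [one_smul] at h1
    rw [neg_smul, one_smul, neg_sub] at h2
    have hF : hessian (empiricalRisk lam z) x = S + lam • 1 := by
      rw [← referenceFun_zero (empiricalRisk lam z), hessian_referenceFun_empiricalRisk hN, add_zero]
    have hf : hessian (empiricalRisk lam fun i => z (idx i ω)) x
        = T (fun i => idx i ω) + lam • 1 := by
      rw [← referenceFun_zero (empiricalRisk lam fun i => z (idx i ω)),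
        hessian_referenceFun_empiricalRisk hn, add_zero]
    rw [hF, hf]
    exact ⟨Matrix.inv_smul_le_add_smul_one_of_deviation hlam hμ hS0 h1,
      Matrix.add_smul_one_le_two_smul_of_deviation h2⟩
  have hPc : P Gᶜ ≤ ENNReal.ofReal δ := by
    calc P Gᶜ ≤ ENNReal.ofReal (δ / 2) + ENNReal.ofReal (δ / 2) :=
          (measure_mono hcompl).trans ((measure_union_le _ _).trans
            (add_le_add (hB (.inl rfl)) (hB (.inr rfl))))
      _ = ENNReal.ofReal δ := by
          rw [← ENNReal.ofReal_add (by positivity) (by positivity), add_halves]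
  rw [ENNReal.ofReal_sub _ hδ.le, ENNReal.ofReal_one, tsub_le_iff_right]
  calc (1 : ℝ≥0∞) = P Set.univ := measure_univ.symm
    -- Subadditivity suffices, so measurability of `G` is not needed.
    _ ≤ P G + P Gᶜ := measure_univ_le_add_compl G
    _ ≤ P G + ENNReal.ofReal δ := by gcongr

theorem mainTheorem2 :
    ∃ C : ℝ, 0 < C ∧
      ∀ (d n N : ℕ) (_hd : 0 < d) (R lam δ : ℝ) (_hlam : 0 < lam) (_hδ : 0 < δ)
        (z : Fin N → EuclideanSpace ℝ (Fin d) × ℝ) (_hR : ∀ i, ‖(z i).1‖ ≤ R)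
        (_hn : 28 / 3 * Real.log (2 * d / δ) < n)
        (Ω : Type*) [MeasurableSpace Ω] (P : Measure Ω) [IsProbabilityMeasure P]
        (idx : Fin n → Ω → Fin N) (_hidx : IsUniformSample P idx),
        let F := empiricalRisk lam z
        let f := fun ω => empiricalRisk lam (fun i => z (idx i ω))
        let μ := precondMu d n R lam δ
        let L : ℝ := 2
        let σ : ℝ := (3 / 2 + 2 * μ / lam)⁻¹
        let κ : ℝ := L / σ
        let κℓ : ℝ := R ^ 2 / lam
        ENNReal.ofReal (1 - δ) ≤
          P {ω |
            (∀ x, (3 / 2 + 2 * μ / lam)⁻¹ • (hessian (f ω) x + μ • 1) ≤ hessian F x ∧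
              hessian F x ≤ (2 : ℝ) • (hessian (f ω) x + μ • 1)) ∧
            RelSmoothStronglyConvex F (referenceFun (f ω) μ) L σ ∧
            κ ≤ C * (1 + κℓ / n * Real.log (2 * d / δ)) ∧
            (2 * δ ≤ d → κ ≤ C * (1 + κℓ / n * Real.log (d / δ)))} := by
  -- The first bound needs `56/3`; replacing `log(2d/δ)` by `2 log(d/δ)` doubles it to `112/3 < 38`.
  refine ⟨38, by norm_num, ?_⟩
  intro d n N hd R lam δ hlam hδ z hR hn Ω _ P _ idx hidx F f μ L σ κ κℓ
  rcases le_or_gt 1 δ with hδ1 | hδ1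
  · rw [ENNReal.ofReal_of_nonpos (by linarith)]
    exact zero_le
  have hd1 : (1 : ℝ) ≤ d := by exact_mod_cast hd
  have hlog : 0 < Real.log (2 * d / δ) :=
    Real.log_pos (by rw [lt_div_iff₀ hδ]; linarith)
  have hn' : (0 : ℝ) < n := lt_trans (by positivity) hn
  have hn0 : n ≠ 0 := by exact_mod_cast hn'.ne'
  have hN0 : N ≠ 0 := by
    obtain ⟨ω⟩ := nonempty_of_isProbabilityMeasure P
    have := (idx ⟨0, Nat.pos_of_ne_zero hn0⟩ ω).pos
    omega
  have hμ : 0 ≤ μ := by simp only [μ, precondMu]; positivity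
  have hκ : κ ≤ 3 + 56 / 3 * (κℓ / n * Real.log (2 * d / δ)) := two_div_inv_precondMu_le hlam hlog.le
  have hκℓ : 0 ≤ κℓ / n := by positivity
  refine (ofReal_le_measure_hessian_le hd hlam hδ hR hn0 hN0 hlog hidx).trans
    (measure_mono fun ω hω => ?_)
  refine ⟨hω, relSmoothStronglyConvex_of_hessian_le hn0 hlam.le hμ hω, ?_, fun hdδ => ?_⟩
  · have := mul_nonneg hκℓ hlog.le
    linarith
  · have h2 : (2 : ℝ) ≤ d / δ := by rwa [le_div_iff₀ hδ]
    have hle : Real.log (2 * d / δ) ≤ 2 * Real.log (d / δ) := by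
      rw [mul_div_assoc, Real.log_mul two_ne_zero (by positivity), two_mul]
      gcongr
    have hnn : 0 ≤ κℓ / n * Real.log (d / δ) :=
      mul_nonneg hκℓ (Real.log_nonneg (by linarith))
    have hmul := mul_le_mul_of_nonneg_left hle hκℓ
    linarith
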